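/- Fix $\sigma>0$. For each integer $A\ge 1$ let $N_A\ge 0$ be an integer (the length of the sync word) and $P_A\ge 0$ a real number (the symbol power), such that $N_A\to\infty$ as $A\to\infty$ and $P_A$ is non-decreasing in $A$. Write $E_A=N_AP_A$ for the sync-packet energy. Model. A sync word $\mathbf s=(s_1,\dots,s_{N_A})$ with symbols $s_i\in\{0,\sqrt{P_A}\}$ is sent over the additive white Gaussian noise channel $y_n=x_n+z_n$ with $z_n$ i.i.d. $\mathcal N(0,\sigma^2)$: $x_n=s_{n-v+1}$ for $v\le n\le v+N_A-1$ and $x_n=0$ in all other slots, where the starting slot $v$ is uniform on $\{1,\dots,A\}$ and independent of the noise. A sequential decoder is a measurable estimate $\hat v$ of $v$ computed from the outputs such that, for every $t$, whether $\hat v=t$ depends only on $y_1,\dots,y_{t+N_A-1}$. Claim. Suppose that $e^{E_A/(2\sigma^2)}>A$ holds with a fixed margin in the exponent, i.e. there is $\varepsilon>0$ such that $$ e^{(1-\varepsilon)\,E_A/(2\sigma^2)} > A \quad\text{for all sufficiently large } A. $$ Then there are sync words $\mathbf s^{N_A}\in\{0,\sqrt{P_A}\}^{N_A}$ and sequential decoders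 $\hat v=\hat v_A$ such that the probability of frame-detection error tends to zero: $\mathsf P_A(\hat v\ne v)\to 0$ as $A\to\infty$. -/

import Mathlib

open MeasureTheory ProbabilityTheory Filter Topology
open scoped NNReal

noncomputable section

/-- The channel input in slot `n` when the sync word `s = (s₁, …, s_N)` is sent from slot `v` on:
the symbol `s_{n - v + 1}` (which has `Fin N`-index `n - v`) in the slots `v, …, v + N - 1`,
and the zero symbol `x(0) = 0` in every other slot. -/
def channelInput {N : ℕ} (s : Fin N → ℝ) (v n : ℕ) : ℝ :=
  if h : v ≤ n ∧ n < v + N then s ⟨n - v, by omega⟩ else 0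

/-- The law of the output sequence `y` of the memoryless additive white Gaussian noise channel with
noise variance `σ²`, given that the sync word `s` is sent from slot `v` on: the outputs are
independent and `y n` is Gaussian with mean the input in slot `n` and variance `σ²`.
The slots are numbered from `1`; the coordinate `y 0` is pure noise that no decoder may use. -/
def awgnOutputLaw (σ : ℝ≥0) {N : ℕ} (s : Fin N → ℝ) (v : ℕ) : Measure (ℕ → ℝ) :=
  Measure.infinitePi fun n => gaussianReal (channelInput s v n) (σ ^ 2)

/-- A sequential decoder for sync words of length `N`: a measurable estimate of the starting slot
from the output sequence such that the decision for `t` depends only on the outputs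
`y 1, …, y (t + N - 1)`. -/
structure SequentialDecoder (N : ℕ) where
  /-- the estimate of the starting slot -/
  estimate : (ℕ → ℝ) → ℕ
  measurable_estimate : Measurable estimate
  causal : ∀ (t : ℕ) (y y' : ℕ → ℝ), (∀ n, 1 ≤ n → n < t + N → y n = y' n) →
    estimate y = t → estimate y' = t

/-- The probability of frame detection error `P(v̂ ≠ v)`, where the starting slot `v` is uniform on
`{1, …, A}`. -/
def frameErrorProb (σ : ℝ≥0) (A : ℕ) {N : ℕ} (s : Fin N → ℝ) (D : SequentialDecoder N) : ℝ :=
  (∑ v ∈ Finset.Icc 1 A, (awgnOutputLaw σ s v).real {y | D.estimate y ≠ v}) / (A : ℝ)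

/-- The energy `E = N · P` of a sync packet of `N` symbols of power `P`. -/
def syncEnergy (N : ℕ) (P : ℝ) : ℝ := (N : ℝ) * P

end

/-! ### Gaussian tail bounds for linear statistics of the channel output -/

/-! The decoder stops at the first slot `t` whose matched filter reaches `1 - δ` times the energy of
the word and which is at least as likely as the next `N - 1` starting slots, judged on the window
`t, …, t + N - 1` alone, so that it is sequential. An error means that the true slot `v` fails or an
earlier slot passes.

If the window of `t` ends before `v`, it holds only noise. There are at most `A` such slots, and the
margin `ε` beats this union bound if the word has energy `(1 - δ) E` (`farFalseAlarmProb_le`). If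
the window overlaps the sync word, the likelihood comparison with `v` has to fail
(`nearFalseAlarmProb_le`). There are at most `N` such slots, so a squared distance between the word
and its shifts that is large against `log N` suffices.

`blockWord` with `m ≈ N ^ (1/4)` has both properties: it has at most `m (m + 1) = o(N)` zeros, and
distance at least `m P` to every shift. Since `P` is eventually bounded below, `E → ∞` and `N exp
(-m P / (8 σ²)) → 0`. -/

lemma hasSubgaussianMGF_sub_gaussianReal (μ : ℝ) (v : ℝ≥0) :
    HasSubgaussianMGF (fun x : ℝ => x - μ) v (gaussianReal μ v) := by
  have h : (gaussianReal μ v).map (fun x => x - μ) = gaussianReal 0 v := by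
    rw [gaussianReal_map_sub_const, sub_self]
  refine ⟨fun t => ?_, fun t => ?_⟩
  · have h1 : Integrable (fun x : ℝ => Real.exp (t * x)) (gaussianReal 0 v) :=
      integrable_exp_mul_gaussianReal t
    rw [← h, integrable_map_measure (by fun_prop) (by fun_prop)] at h1
    exact h1
  · rw [mgf_gaussianReal h]
    simp

instance isProbabilityMeasure_awgnOutputLaw (σ : ℝ≥0) {N : ℕ} (s : Fin N → ℝ) (v : ℕ) :
    IsProbabilityMeasure (awgnOutputLaw σ s v) := by
  unfold awgnOutputLaw
  infer_instance

lemma awgnOutputLaw_real_le_sum_mul_noise_le (σ : ℝ≥0) {N : ℕ} (s : Fin N → ℝ) (v : ℕ)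
    (a : ℕ → ℝ) (F : Finset ℕ) {r : ℝ} (hr : 0 ≤ r) :
    (awgnOutputLaw σ s v).real {y | r ≤ ∑ n ∈ F, a n * (y n - channelInput s v n)} ≤
      Real.exp (-r ^ 2 / (2 * ((σ : ℝ) ^ 2 * ∑ n ∈ F, a n ^ 2))) := by
  have hindep : iIndepFun (fun (n : ℕ) (y : ℕ → ℝ) => a n * (y n - channelInput s v n))
      (awgnOutputLaw σ s v) :=
    iIndepFun_infinitePi (P := fun n => gaussianReal (channelInput s v n) (σ ^ 2))
      (X := fun n (x : ℝ) => a n * (x - channelInput s v n)) (fun n => by fun_prop)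
  have hsub : ∀ n ∈ F, HasSubgaussianMGF
      (fun y : ℕ → ℝ => a n * (y n - channelInput s v n))
      (⟨a n ^ 2, sq_nonneg _⟩ * σ ^ 2) (awgnOutputLaw σ s v) := by
    intro n _
    refine HasSubgaussianMGF.const_mul ?_ (a n)
    have h := hasSubgaussianMGF_sub_gaussianReal (channelInput s v n) (σ ^ 2)
    rw [← Measure.infinitePi_map_eval
      (fun n => gaussianReal (channelInput s v n) (σ ^ 2)) n] at h
    have hn : Measurable fun y : ℕ → ℝ => y n := measurable_pi_apply n
    exact HasSubgaussianMGF.of_map hn.aemeasurable h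
  refine (HasSubgaussianMGF.measure_sum_ge_le_of_iIndepFun hindep hsub hr).trans_eq ?_
  congr 3
  push_cast
  rw [Finset.mul_sum]
  refine Finset.sum_congr rfl fun n _ => ?_
  change a n ^ 2 * ((σ ^ 2 : ℝ≥0) : ℝ) = _
  rw [NNReal.coe_pow, mul_comm]

lemma awgnOutputLaw_real_mul_le_correlation_le (σ : ℝ≥0) {N : ℕ} (s : Fin N → ℝ) (v : ℕ)
    (a : ℕ → ℝ) (F : Finset ℕ) {c : ℝ} (hc : 0 ≤ c) :
    (awgnOutputLaw σ s v).real
        {y | c * ∑ n ∈ F, a n ^ 2 ≤ ∑ n ∈ F, a n * (y n - channelInput s v n)} ≤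
      Real.exp (-(c ^ 2 * ∑ n ∈ F, a n ^ 2) / (2 * (σ : ℝ) ^ 2)) := by
  have hS : 0 ≤ ∑ n ∈ F, a n ^ 2 := Finset.sum_nonneg fun n _ => sq_nonneg _
  refine (awgnOutputLaw_real_le_sum_mul_noise_le σ s v a F (mul_nonneg hc hS)).trans_eq ?_
  congr 1
  -- In the degenerate cases both exponents are `0`, by `x / 0 = 0`.
  rcases hS.eq_or_lt with h0 | h0
  · simp [← h0]
  · rcases eq_or_ne (σ : ℝ) 0 with h1 | h1
    · simp [h1]
    · field_simp

/-- The probability that the likelihood test prefers the signal `u` to the transmitted one. -/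
lemma awgnOutputLaw_real_likelihood_error_le (σ : ℝ≥0) {N : ℕ} (s : Fin N → ℝ) (v : ℕ)
    (u w : ℕ → ℝ) (F : Finset ℕ) (hw : ∀ n ∈ F, channelInput s v n = w n) {d : ℝ}
    (hd : d ≤ ∑ n ∈ F, (u n - w n) ^ 2) :
    (awgnOutputLaw σ s v).real
        {y | (∑ n ∈ F, (u n ^ 2 - w n ^ 2)) / 2 ≤ ∑ n ∈ F, (u n - w n) * y n} ≤
      Real.exp (-d / (8 * (σ : ℝ) ^ 2)) := by
  -- The noise correlation is the likelihood margin plus half the squared distance, so an error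
  -- forces the event with `c = 1 / 2`.
  have hkey : ∀ y : ℕ → ℝ, ∑ n ∈ F, (u n - w n) * (y n - channelInput s v n) =
      ∑ n ∈ F, (u n - w n) * y n - (∑ n ∈ F, (u n ^ 2 - w n ^ 2)) / 2 +
        1 / 2 * ∑ n ∈ F, (u n - w n) ^ 2 := by
    intro y
    rw [Finset.sum_div, Finset.mul_sum, ← Finset.sum_sub_distrib, ← Finset.sum_add_distrib]
    refine Finset.sum_congr rfl fun n hn => ?_
    rw [hw n hn]
    ring
  calc _ ≤ (awgnOutputLaw σ s v).real {y | 1 / 2 * ∑ n ∈ F, (u n - w n) ^ 2 ≤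
        ∑ n ∈ F, (u n - w n) * (y n - channelInput s v n)} := by
        refine measureReal_mono fun y hy => ?_
        simp only [Set.mem_ofPred_eq, hkey y] at hy ⊢
        linarith
    _ ≤ _ := awgnOutputLaw_real_mul_le_correlation_le σ s v (fun n => u n - w n) F
        (by norm_num)
    _ ≤ _ := by
        refine Real.exp_le_exp.2 ?_
        rcases eq_or_ne (σ : ℝ) 0 with h1 | h1
        · simp [h1]
        · rw [div_le_div_iff₀ (by positivity) (by positivity)]
          nlinarith [mul_le_mul_of_nonneg_right hd (sq_nonneg (σ : ℝ))]

/-! ### Sequential decoders from threshold tests -/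

section Decoder

open Classical in
/-- The decoder that stops at the first slot passing the causal test `p`, and in slot `A` at the
latest. -/
noncomputable def SequentialDecoder.ofTest (N A : ℕ) (p : ℕ → (ℕ → ℝ) → Prop)
    (hp : ∀ t, MeasurableSet {y | p t y})
    (hcausal : ∀ t y y', 1 ≤ t → (∀ n, 1 ≤ n → n < t + N → y n = y' n) → p t y → p t y') :
    SequentialDecoder N where
  -- The witness `A + 1`, unlike `A`, is at least `1` even for `A = 0`.
  estimate y := Nat.find (p := fun t => 1 ≤ t ∧ (A ≤ t ∨ p t y)) ⟨A + 1, by omega, by omega⟩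
  measurable_estimate := by
    refine measurable_find (p := fun y t => 1 ≤ t ∧ (A ≤ t ∨ p t y)) _ fun t => ?_
    exact (MeasurableSet.const (1 ≤ t)).inter ((MeasurableSet.const (A ≤ t)).union (hp t))
  causal := by
    intro t y y' h ht
    rw [Nat.find_eq_iff] at ht ⊢
    refine ⟨⟨ht.1.1, ht.1.2.imp_right (hcausal t y y' ht.1.1 h)⟩, fun m hm hm' => ht.2 m hm ?_⟩
    exact ⟨hm'.1, hm'.2.imp_right (hcausal m y' y hm'.1 fun n h1 h2 => (h n h1 (by omega)).symm)⟩

lemma SequentialDecoder.ofTest_estimate_eq {N A : ℕ} {p : ℕ → (ℕ → ℝ) → Prop}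
    {hp : ∀ t, MeasurableSet {y | p t y}}
    {hcausal : ∀ t y y', 1 ≤ t → (∀ n, 1 ≤ n → n < t + N → y n = y' n) → p t y → p t y'}
    {v : ℕ} {y : ℕ → ℝ} (hv : v ∈ Finset.Icc 1 A) (h : p v y)
    (h' : ∀ t ∈ Finset.Ico 1 v, ¬ p t y) :
    (SequentialDecoder.ofTest N A p hp hcausal).estimate y = v := by
  classical
  rw [Finset.mem_Icc] at hv
  refine (Nat.find_eq_iff _).2 ⟨⟨hv.1, Or.inr h⟩, ?_⟩
  rintro t ht ⟨h1, h2 | h2⟩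
  · omega
  · exact h' t (Finset.mem_Ico.2 ⟨h1, ht⟩) h2

/-- The matched filter for slot `t` exceeds the fraction `c` of the energy of the sync word, and
slot `t` is at least as likely as each of the later slots `t + 1, …, t + N - 1`. -/
def PassesSyncTest {N : ℕ} (s : Fin N → ℝ) (c : ℝ) (t : ℕ) (y : ℕ → ℝ) : Prop :=
  c * ∑ n ∈ Finset.Ico t (t + N), channelInput s t n ^ 2 ≤
      ∑ n ∈ Finset.Ico t (t + N), channelInput s t n * y n ∧
    ∀ k ∈ Finset.Ico 1 N,
      (∑ n ∈ Finset.Ico t (t + N), (channelInput s t n ^ 2 - channelInput s (t + k) n ^ 2)) / 2 ≤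
        ∑ n ∈ Finset.Ico t (t + N), (channelInput s t n - channelInput s (t + k) n) * y n

lemma measurableSet_passesSyncTest {N : ℕ} (s : Fin N → ℝ) (c : ℝ) (t : ℕ) :
    MeasurableSet {y | PassesSyncTest s c t y} := by
  have hlin : ∀ (F : Finset ℕ) (a : ℕ → ℝ) (b : ℝ),
      MeasurableSet {y : ℕ → ℝ | b ≤ ∑ n ∈ F, a n * y n} := by
    intro F a b
    refine measurableSet_le measurable_const (Finset.measurable_sum _ fun n _ => ?_)
    have hn : Measurable fun y : ℕ → ℝ => y n := measurable_pi_apply n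
    exact hn.const_mul (a n)
  have hset : {y | PassesSyncTest s c t y} =
      {y | c * ∑ n ∈ Finset.Ico t (t + N), channelInput s t n ^ 2 ≤
        ∑ n ∈ Finset.Ico t (t + N), channelInput s t n * y n} ∩
      ⋂ k ∈ Finset.Ico 1 N, {y | (∑ n ∈ Finset.Ico t (t + N),
          (channelInput s t n ^ 2 - channelInput s (t + k) n ^ 2)) / 2 ≤
        ∑ n ∈ Finset.Ico t (t + N), (channelInput s t n - channelInput s (t + k) n) * y n} := by
    ext y
    simp [PassesSyncTest]
  rw [hset]
  exact (hlin _ _ _).inter (Finset.measurableSet_biInter _ fun k _ =>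
    hlin _ (fun n => channelInput s t n - channelInput s (t + k) n) _)

lemma PassesSyncTest.congr {N : ℕ} {s : Fin N → ℝ} {c : ℝ} (t : ℕ) (y y' : ℕ → ℝ) (ht : 1 ≤ t)
    (h : ∀ n, 1 ≤ n → n < t + N → y n = y' n) (hy : PassesSyncTest s c t y) :
    PassesSyncTest s c t y' := by
  have hsum : ∀ a : ℕ → ℝ, ∑ n ∈ Finset.Ico t (t + N), a n * y n =
      ∑ n ∈ Finset.Ico t (t + N), a n * y' n := fun a =>
    Finset.sum_congr rfl fun n hn => by
      rw [Finset.mem_Ico] at hn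
      rw [h n (by omega) hn.2]
  unfold PassesSyncTest at hy ⊢
  simpa only [hsum] using hy

/-- The decoder that stops at the first slot passing the sync test. -/
noncomputable def syncDecoder {N : ℕ} (s : Fin N → ℝ) (c : ℝ) (A : ℕ) : SequentialDecoder N :=
  SequentialDecoder.ofTest N A (PassesSyncTest s c) (measurableSet_passesSyncTest s c)
    PassesSyncTest.congr

end Decoder

/-! ### Error probability of the sync decoder -/

section Error

variable (σ : ℝ≥0) {N : ℕ} (s : Fin N → ℝ) {δ w d : ℝ}

/-- The true slot fails only if the noise lowers the matched filter by `δ` times the energy, or if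
one of fewer than `N` later slots looks more likely. -/
lemma missProb_le (hδ : 0 ≤ δ)
    (hw : ∀ t, w ≤ ∑ n ∈ Finset.Ico t (t + N), channelInput s t n ^ 2)
    (hd : ∀ t k, 1 ≤ k →
      d ≤ ∑ n ∈ Finset.Ico t (t + N), (channelInput s t n - channelInput s (t + k) n) ^ 2)
    (v : ℕ) :
    (awgnOutputLaw σ s v).real {y | ¬ PassesSyncTest s (1 - δ) v y} ≤
      Real.exp (-(δ ^ 2 * w) / (2 * (σ : ℝ) ^ 2)) + N * Real.exp (-d / (8 * (σ : ℝ) ^ 2)) := by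
  set F := Finset.Ico v (v + N)
  set x := channelInput s v
  have hsub : {y | ¬ PassesSyncTest s (1 - δ) v y} ⊆
      {y | δ * ∑ n ∈ F, (-x n) ^ 2 ≤ ∑ n ∈ F, -x n * (y n - x n)} ∪
      ⋃ k ∈ Finset.Ico 1 N, {y | (∑ n ∈ F, (channelInput s (v + k) n ^ 2 - x n ^ 2)) / 2 ≤
        ∑ n ∈ F, (channelInput s (v + k) n - x n) * y n} := by
    intro y hy
    by_cases h1 : (1 - δ) * ∑ n ∈ F, x n ^ 2 ≤ ∑ n ∈ F, x n * y n
    · right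
      have h2 : ¬ ∀ k ∈ Finset.Ico 1 N, (∑ n ∈ F, (x n ^ 2 - channelInput s (v + k) n ^ 2)) / 2 ≤
        ∑ n ∈ F, (x n - channelInput s (v + k) n) * y n := fun h => hy ⟨h1, h⟩
      push Not at h2
      obtain ⟨k, hk, h3⟩ := h2
      simp only [Set.mem_iUnion]
      refine ⟨k, hk, ?_⟩
      simp only [Set.mem_ofPred_eq, sub_mul, Finset.sum_sub_distrib] at h3 ⊢
      linarith
    · left
      have h2 : ∑ n ∈ F, -x n * (y n - x n) = ∑ n ∈ F, x n ^ 2 - ∑ n ∈ F, x n * y n := by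
        rw [← Finset.sum_sub_distrib]
        exact Finset.sum_congr rfl fun n _ => by ring
      simp only [Set.mem_ofPred_eq, h2, neg_sq]
      linarith
  refine (measureReal_mono hsub).trans ((measureReal_union_le _ _).trans (add_le_add ?_ ?_))
  · refine (awgnOutputLaw_real_mul_le_correlation_le σ s v (fun n => -x n) F hδ).trans ?_
    refine Real.exp_le_exp.2 (div_le_div_of_nonneg_right ?_ (by positivity))
    simp only [neg_sq]
    exact neg_le_neg (mul_le_mul_of_nonneg_left (hw v) (sq_nonneg δ))
  · refine (measureReal_biUnion_finset_le _ _).trans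
      ((Finset.sum_le_card_nsmul _ _ (Real.exp (-d / (8 * (σ : ℝ) ^ 2))) fun k hk => ?_).trans ?_)
    · refine awgnOutputLaw_real_likelihood_error_le σ s v _ _ F (fun n _ => rfl)
        ((hd v k (Finset.mem_Ico.1 hk).1).trans_eq ?_)
      exact Finset.sum_congr rfl fun n _ => by ring
    · rw [nsmul_eq_mul, Nat.card_Ico]
      refine mul_le_mul_of_nonneg_right ?_ (Real.exp_pos _).le
      exact_mod_cast Nat.sub_le _ _

lemma farFalseAlarmProb_le (hδ : δ ≤ 1)
    (hw : ∀ t, w ≤ ∑ n ∈ Finset.Ico t (t + N), channelInput s t n ^ 2)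
    {t v : ℕ} (h : t + N ≤ v) :
    (awgnOutputLaw σ s v).real {y | PassesSyncTest s (1 - δ) t y} ≤
      Real.exp (-((1 - δ) ^ 2 * w) / (2 * (σ : ℝ) ^ 2)) := by
  refine (measureReal_mono fun y hy => ?_).trans
    ((awgnOutputLaw_real_mul_le_correlation_le σ s v (channelInput s t) (Finset.Ico t (t + N))
      (sub_nonneg.2 hδ)).trans ?_)
  · refine hy.1.trans_eq (Finset.sum_congr rfl fun n hn => ?_)
    rw [Finset.mem_Ico] at hn
    have : channelInput s v n = 0 := dif_neg (by omega)
    rw [this, sub_zero]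
  · refine Real.exp_le_exp.2 (div_le_div_of_nonneg_right ?_ (by positivity))
    exact neg_le_neg (mul_le_mul_of_nonneg_left (hw t) (sq_nonneg _))

/-- The true slot is itself one of the later slots that `t` has to match in likelihood. -/
lemma nearFalseAlarmProb_le
    (hd : ∀ t k, 1 ≤ k →
      d ≤ ∑ n ∈ Finset.Ico t (t + N), (channelInput s t n - channelInput s (t + k) n) ^ 2)
    (c : ℝ) {t v : ℕ} (h : t < v) (h' : v < t + N) :
    (awgnOutputLaw σ s v).real {y | PassesSyncTest s c t y} ≤
      Real.exp (-d / (8 * (σ : ℝ) ^ 2)) := by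
  obtain ⟨k, rfl⟩ := Nat.exists_eq_add_of_lt h
  refine (measureReal_mono fun y hy => ?_).trans
    (awgnOutputLaw_real_likelihood_error_le σ s _ (channelInput s t) _
      (Finset.Ico t (t + N)) (fun n _ => rfl) (hd t (k + 1) (by omega)))
  exact hy.2 (k + 1) (Finset.mem_Ico.2 (by omega))

lemma syncDecoder_error_le (hδ : 0 ≤ δ) (hδ1 : δ ≤ 1)
    (hw : ∀ t, w ≤ ∑ n ∈ Finset.Ico t (t + N), channelInput s t n ^ 2)
    (hd : ∀ t k, 1 ≤ k →
      d ≤ ∑ n ∈ Finset.Ico t (t + N), (channelInput s t n - channelInput s (t + k) n) ^ 2)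
    {A v : ℕ} (hv : v ∈ Finset.Icc 1 A) :
    (awgnOutputLaw σ s v).real {y | (syncDecoder s (1 - δ) A).estimate y ≠ v} ≤
      Real.exp (-(δ ^ 2 * w) / (2 * (σ : ℝ) ^ 2)) +
        2 * (N * Real.exp (-d / (8 * (σ : ℝ) ^ 2))) +
        A * Real.exp (-((1 - δ) ^ 2 * w) / (2 * (σ : ℝ) ^ 2)) := by
  set q := Real.exp (-d / (8 * (σ : ℝ) ^ 2))
  set α := Real.exp (-((1 - δ) ^ 2 * w) / (2 * (σ : ℝ) ^ 2))
  have hq : 0 ≤ q := (Real.exp_pos _).le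
  have hα : 0 ≤ α := (Real.exp_pos _).le
  have hsub : {y | (syncDecoder s (1 - δ) A).estimate y ≠ v} ⊆
      {y | ¬ PassesSyncTest s (1 - δ) v y} ∪
        ⋃ t ∈ Finset.Ico 1 v, {y | PassesSyncTest s (1 - δ) t y} := by
    intro y hy
    by_contra hcon
    simp only [Set.mem_union, Set.mem_iUnion, Set.mem_ofPred_eq, not_or, not_not, not_exists]
      at hcon
    exact hy (SequentialDecoder.ofTest_estimate_eq hv hcon.1 hcon.2)
  have hfalse : ∑ t ∈ Finset.Ico 1 v, (awgnOutputLaw σ s v).real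
      {y | PassesSyncTest s (1 - δ) t y} ≤ A * α + N * q := by
    -- Charging `α` to every slot leaves only the count of overlapping slots, those in `(v - N, v)`.
    calc _ ≤ ∑ t ∈ Finset.Ico 1 v, (α + if v < t + N then q else 0) := by
          refine Finset.sum_le_sum fun t ht => ?_
          split_ifs with h
          · exact (nearFalseAlarmProb_le σ s hd _ (Finset.mem_Ico.1 ht).2 h).trans
              (le_add_of_nonneg_left hα)
          · exact (farFalseAlarmProb_le σ s hδ1 hw (not_lt.1 h)).trans_eq (add_zero _).symm
      _ = ((Finset.Ico 1 v).card : ℝ) * α +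
          (((Finset.Ico 1 v).filter fun t => v < t + N).card : ℝ) * q := by
          rw [Finset.sum_add_distrib, ← Finset.sum_filter]
          simp only [Finset.sum_const, nsmul_eq_mul]
      _ ≤ _ := by
          have h1 : (Finset.Ico 1 v).card ≤ A := by
            rw [Nat.card_Ico]
            have := (Finset.mem_Icc.1 hv).2
            omega
          have h2 : ((Finset.Ico 1 v).filter fun t => v < t + N).card ≤ N := by
            refine (Finset.card_le_card (t := Finset.Ico (v + 1 - N) v) fun t ht => ?_).trans ?_
            · simp only [Finset.mem_filter, Finset.mem_Ico] at ht ⊢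
              omega
            · rw [Nat.card_Ico]
              omega
          gcongr
  have hmiss := missProb_le σ s hδ hw hd v
  have := (measureReal_mono (μ := awgnOutputLaw σ s v) hsub).trans
    ((measureReal_union_le _ _).trans
      (add_le_add hmiss ((measureReal_biUnion_finset_le _ _).trans hfalse)))
  linarith

lemma frameErrorProb_syncDecoder_le (hδ : 0 ≤ δ) (hδ1 : δ ≤ 1)
    (hw : ∀ t, w ≤ ∑ n ∈ Finset.Ico t (t + N), channelInput s t n ^ 2)
    (hd : ∀ t k, 1 ≤ k →
      d ≤ ∑ n ∈ Finset.Ico t (t + N), (channelInput s t n - channelInput s (t + k) n) ^ 2)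
    {A : ℕ} (hA : 1 ≤ A) :
    frameErrorProb σ A s (syncDecoder s (1 - δ) A) ≤
      Real.exp (-(δ ^ 2 * w) / (2 * (σ : ℝ) ^ 2)) +
        2 * (N * Real.exp (-d / (8 * (σ : ℝ) ^ 2))) +
        A * Real.exp (-((1 - δ) ^ 2 * w) / (2 * (σ : ℝ) ^ 2)) := by
  have hA' : (0 : ℝ) < A := by exact_mod_cast hA
  unfold frameErrorProb
  rw [div_le_iff₀ hA']
  refine (Finset.sum_le_card_nsmul _ _ _ fun v hv =>
    syncDecoder_error_le σ s hδ hδ1 hw hd hv).trans_eq ?_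
  rw [nsmul_eq_mul, Nat.card_Icc, Nat.add_sub_cancel, mul_comm]

end Error

/-! ### Sync words of large weight far from all their shifts -/

/-- The word of `N` symbols `√P`, with symbol `0` in every second one of its first blocks of
length `m`. -/
noncomputable def blockWord (N m : ℕ) (P : ℝ) (i : Fin N) : ℝ :=
  if (i / m) % 2 = 1 ∧ i / m ≤ m then 0 else Real.sqrt P

lemma channelInput_add {N : ℕ} (s : Fin N → ℝ) (t : ℕ) {i : ℕ} (hi : i < N) :
    channelInput s t (t + i) = s ⟨i, hi⟩ := by
  unfold channelInput
  rw [dif_pos (by omega)]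
  congr 2
  omega

lemma channelInput_shift_add {N : ℕ} (s : Fin N → ℝ) (t : ℕ) {i k : ℕ} (hi : i < N)
    (hk : k ≤ i) : channelInput s (t + k) (t + i) = s ⟨i - k, by omega⟩ := by
  unfold channelInput
  rw [dif_pos (by omega)]
  congr 2
  omega

/-- Zeros occur only in the blocks `0, …, m`, that is, among the first `m (m + 1)` symbols. -/
lemma le_energy_blockWord {N m : ℕ} {P : ℝ} (hP : 0 ≤ P) (t : ℕ) :
    ((N : ℝ) - m * (m + 1)) * P ≤
      ∑ n ∈ Finset.Ico t (t + N), channelInput (blockWord N m P) t n ^ 2 := by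
  calc ((N : ℝ) - m * (m + 1)) * P
      ≤ ((Finset.Ico (t + m * (m + 1)) (t + N)).card : ℝ) * P := by
        refine mul_le_mul_of_nonneg_right ?_ hP
        rw [Nat.card_Ico, sub_le_iff_le_add]
        have : N ≤ t + N - (t + m * (m + 1)) + m * (m + 1) := by omega
        exact_mod_cast this
    _ = ∑ n ∈ Finset.Ico (t + m * (m + 1)) (t + N), channelInput (blockWord N m P) t n ^ 2 := by
        rw [← nsmul_eq_mul, ← Finset.sum_const]
        refine Finset.sum_congr rfl fun n hn => ?_
        rw [Finset.mem_Ico] at hn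
        obtain ⟨i, rfl⟩ := Nat.exists_eq_add_of_le (show t ≤ n by omega)
        rw [channelInput_add _ t (show i < N by omega), blockWord, if_neg, Real.sq_sqrt hP]
        rintro ⟨h1, h2⟩
        rcases Nat.eq_zero_or_pos m with rfl | hm
        · simp at h1
        · have : i < m * (m + 1) := by
            rw [mul_comm]
            exact (Nat.div_lt_iff_lt_mul hm).1 (Nat.lt_succ_of_le h2)
          omega
    _ ≤ _ := by
        refine Finset.sum_le_sum_of_subset_of_nonneg ?_ fun _ _ _ => sq_nonneg _
        exact Finset.Ico_subset_Ico_left (by omega)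

lemma card_mul_le_sum_sq_sub {F J : Finset ℕ} {f : ℕ → ℕ} {u w : ℕ → ℝ} {P : ℝ}
    (hf : Set.InjOn f J) (hF : ∀ j ∈ J, f j ∈ F) (h : ∀ j ∈ J, (u (f j) - w (f j)) ^ 2 = P) :
    (J.card : ℝ) * P ≤ ∑ n ∈ F, (u n - w n) ^ 2 := by
  rw [← nsmul_eq_mul, ← Finset.sum_const, ← Finset.sum_congr rfl h,
    ← Finset.sum_image (f := fun n => (u n - w n) ^ 2) hf]
  exact Finset.sum_le_sum_of_subset_of_nonneg (Finset.image_subset_iff.2 hF)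
    fun _ _ _ => sq_nonneg _

/-- For `k ≤ m`, the positions `j m` and `j m - k` with `1 ≤ j ≤ m` lie in adjacent blocks, exactly
one of which is zero. For `k > m`, the first block, all `√P`, meets slots where the shifted word has
not begun. Either way `m` symbols differ. -/
lemma le_dist_shift_blockWord {N m : ℕ} {P : ℝ} (hP : 0 ≤ P) (hmN : m * m < N) (t k : ℕ)
    (hk : 1 ≤ k) :
    m * P ≤ ∑ n ∈ Finset.Ico t (t + N),
      (channelInput (blockWord N m P) t n - channelInput (blockWord N m P) (t + k) n) ^ 2 := by
  rcases Nat.eq_zero_or_pos m with rfl | hm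
  · simpa using Finset.sum_nonneg fun _ _ => sq_nonneg _
  rcases le_or_gt k m with hkm | hkm
  · have := card_mul_le_sum_sq_sub (J := Finset.Icc 1 m) (f := fun j => t + j * m)
      (F := Finset.Ico t (t + N)) (u := channelInput (blockWord N m P) t)
      (w := channelInput (blockWord N m P) (t + k)) (P := P) ?_ ?_ ?_
    · simpa using this
    · intro a _ b _ hab
      exact Nat.eq_of_mul_eq_mul_right hm (Nat.add_left_cancel hab)
    · intro j hj
      rw [Finset.mem_Icc] at hj
      have := Nat.mul_le_mul_right m hj.2
      rw [Finset.mem_Ico]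
      omega
    · intro j hj
      rw [Finset.mem_Icc] at hj
      have h1 := Nat.mul_le_mul_right m hj.2
      have h2 := Nat.mul_le_mul_right m hj.1
      rw [one_mul] at h2
      rw [channelInput_add _ t (show j * m < N by omega),
        channelInput_shift_add _ t (show j * m < N by omega) (by omega)]
      obtain ⟨l, rfl⟩ := Nat.exists_eq_add_of_le' hj.1
      have h3 : (l + 1) * m / m = l + 1 := Nat.mul_div_cancel _ hm
      have h4 : ((l + 1) * m - k) / m = l := by
        rw [Nat.div_eq_iff hm]
        have : (l + 1) * m = l * m + m := by ring
        omega
      simp only [blockWord, h3, h4]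
      rcases Nat.mod_two_eq_zero_or_one l with h | h
      · rw [if_pos ⟨by omega, hj.2⟩, if_neg (by omega), zero_sub, neg_sq, Real.sq_sqrt hP]
      · rw [if_neg (by omega), if_pos ⟨h, by omega⟩, sub_zero, Real.sq_sqrt hP]
  · have hmm : m ≤ m * m := Nat.le_mul_self m
    have := card_mul_le_sum_sq_sub (J := Finset.range m) (f := fun j => t + j)
      (F := Finset.Ico t (t + N)) (u := channelInput (blockWord N m P) t)
      (w := channelInput (blockWord N m P) (t + k)) (P := P) ?_ ?_ ?_
    · simpa using this
    · intro a _ b _ hab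
      exact Nat.add_left_cancel hab
    · intro j hj
      rw [Finset.mem_range] at hj
      rw [Finset.mem_Ico]
      omega
    · intro j hj
      rw [Finset.mem_range] at hj
      have h0 : channelInput (blockWord N m P) (t + k) (t + j) = 0 := dif_neg (by omega)
      rw [h0, channelInput_add _ t (show j < N by omega), sub_zero, blockWord, if_neg,
        Real.sq_sqrt hP]
      rw [Nat.div_eq_of_lt hj]
      simp

/-! ### Asymptotics -/

lemma lt_sqrt_sqrt_add_one_pow (n : ℕ) : n < (n.sqrt.sqrt + 1) ^ 4 := by
  have h1 := Nat.lt_succ_sqrt n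
  have h2 : n.sqrt + 1 ≤ (n.sqrt.sqrt + 1) * (n.sqrt.sqrt + 1) := Nat.lt_succ_sqrt n.sqrt
  calc n < (n.sqrt + 1) * (n.sqrt + 1) := h1
    _ ≤ _ := Nat.mul_le_mul h2 h2
    _ = _ := by ring

lemma tendsto_sqrt_sqrt_atTop : Tendsto (fun n : ℕ => n.sqrt.sqrt) atTop atTop := by
  refine tendsto_atTop.2 fun b => ?_
  filter_upwards [eventually_ge_atTop (b * b * (b * b))] with n hn
  exact Nat.le_sqrt.2 (Nat.le_sqrt.2 hn)

lemma sqrt_sqrt_pow_le (n : ℕ) : n.sqrt.sqrt ^ 4 ≤ n :=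
  calc n.sqrt.sqrt ^ 4 = (n.sqrt.sqrt * n.sqrt.sqrt) * (n.sqrt.sqrt * n.sqrt.sqrt) := by ring
    _ ≤ n.sqrt * n.sqrt := Nat.mul_le_mul (Nat.sqrt_le _) (Nat.sqrt_le _)
    _ ≤ n := Nat.sqrt_le _

/-- With `m = n.sqrt.sqrt ≥ 1`, the factor `n` is at most `16 m ^ 4`, which the exponential in `m`
absorbs. -/
lemma tendsto_mul_exp_neg_mul_sqrt_sqrt {c : ℝ} (hc : 0 < c) :
    Tendsto (fun n : ℕ => (n : ℝ) * Real.exp (-c * (n.sqrt.sqrt : ℝ))) atTop (𝓝 0) := by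
  have h1 : Tendsto (fun x : ℝ => 16 * (x ^ 4 * Real.exp (-c * x))) atTop (𝓝 0) := by
    have h := Real.tendsto_pow_mul_exp_neg_atTop_nhds_zero 4
    have h2 := (h.comp (tendsto_id.const_mul_atTop hc)).const_mul (16 / c ^ 4)
    rw [mul_zero] at h2
    refine h2.congr fun x => ?_
    simp only [Function.comp, id]
    rw [mul_pow, neg_mul]
    field_simp
  have h3 := h1.comp (tendsto_natCast_atTop_atTop.comp tendsto_sqrt_sqrt_atTop)
  refine squeeze_zero' (Eventually.of_forall fun n => by positivity) ?_ h3
  filter_upwards [tendsto_sqrt_sqrt_atTop.eventually_ge_atTop 1] with n hn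
  simp only [Function.comp]
  rw [← mul_assoc]
  refine mul_le_mul_of_nonneg_right ?_ (Real.exp_pos _).le
  have h4 : n ≤ 16 * n.sqrt.sqrt ^ 4 :=
    calc n ≤ (n.sqrt.sqrt + 1) ^ 4 := (lt_sqrt_sqrt_add_one_pow n).le
      _ ≤ (2 * n.sqrt.sqrt) ^ 4 := Nat.pow_le_pow_left (by omega) 4
      _ = _ := by ring
  exact_mod_cast h4

theorem corollary1 (σ : ℝ≥0) (hσ : 0 < σ)
    (P : ℕ → ℝ) (hP_nonneg : ∀ A, 1 ≤ A → 0 ≤ P A) (hP_mono : MonotoneOn P (Set.Ici 1))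
    (N : ℕ → ℕ) (hN : Tendsto N atTop atTop)
    (ε : ℝ) (hε : 0 < ε)
    (hA : ∀ᶠ A : ℕ in atTop,
      (A : ℝ) < Real.exp ((1 - ε) * (syncEnergy (N A) (P A) / (2 * (σ : ℝ) ^ 2)))) :
    ∃ (s : (A : ℕ) → Fin (N A) → ℝ) (D : (A : ℕ) → SequentialDecoder (N A)),
      (∀ A i, s A i = 0 ∨ s A i = Real.sqrt (P A)) ∧
      Tendsto (fun A : ℕ => frameErrorProb σ A (s A) (D A)) atTop (𝓝 0) := by
  have hσ' : (0 : ℝ) < σ := by exact_mod_cast hσ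
  -- At a single `A ≥ 1`, `P A = 0` would turn the hypothesis into `A < 1`; monotonicity carries the
  -- positive value onwards.
  obtain ⟨p, hp, hPp⟩ : ∃ p : ℝ, 0 < p ∧ ∀ᶠ A : ℕ in atTop, p ≤ P A := by
    obtain ⟨A, hlt, hA1⟩ := (hA.and (eventually_ge_atTop 1)).exists
    refine ⟨P A, (hP_nonneg A hA1).lt_of_ne fun h0 => ?_, ?_⟩
    · rw [← h0] at hlt
      simp only [syncEnergy, mul_zero, zero_div, Real.exp_zero] at hlt
      exact absurd hlt (not_lt.2 (by exact_mod_cast hA1))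
    · filter_upwards [eventually_ge_atTop A] with B hB
      exact hP_mono hA1 (hA1.trans hB) hB
  -- The far false alarm exponent loses three factors `1 - δ`, two from the threshold and one from
  -- the zeros of the word; `3 δ ≤ ε / 2` keeps half of the margin.
  obtain ⟨δ, hδ, hδ1, hδε⟩ : ∃ δ : ℝ, 0 < δ ∧ δ < 1 ∧ 3 * δ ≤ ε / 2 :=
    ⟨min (ε / 6) (1 / 2), by positivity, (min_le_right _ _).trans_lt (by norm_num),
      by linarith [min_le_left (ε / 6) (1 / 2 : ℝ)]⟩
  set M : ℕ → ℕ := fun A => (N A).sqrt.sqrt with hM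
  set E : ℕ → ℝ := fun A => syncEnergy (N A) (P A) with hE
  have hMtop : Tendsto M atTop atTop := tendsto_sqrt_sqrt_atTop.comp hN
  have hEtop : Tendsto E atTop atTop := by
    refine tendsto_atTop_mono' _ ?_
      ((tendsto_natCast_atTop_atTop (R := ℝ).comp hN).atTop_mul_const hp)
    filter_upwards [hPp] with A h
    exact mul_le_mul_of_nonneg_left h (Nat.cast_nonneg _)
  have hexp : ∀ c : ℝ, 0 < c → Tendsto (fun A => Real.exp (-(c * E A))) atTop (𝓝 0) :=
    fun c hc => Real.tendsto_exp_neg_atTop_nhds_zero.comp (hEtop.const_mul_atTop hc)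
  refine ⟨fun A => blockWord (N A) (M A) (P A),
    fun A => syncDecoder (blockWord (N A) (M A) (P A)) (1 - δ) A, fun A i => ?_, ?_⟩
  · dsimp only [blockWord]
    split_ifs <;> simp
  have hlim : Tendsto (fun A => Real.exp (-(δ ^ 2 * (1 - δ) / (2 * (σ : ℝ) ^ 2) * E A)) +
      2 * ((N A : ℝ) * Real.exp (-(p / (8 * (σ : ℝ) ^ 2)) * (M A : ℝ))) +
      Real.exp (-(ε / 2 / (2 * (σ : ℝ) ^ 2) * E A))) atTop (𝓝 0) := by
    have h1 : 0 < 1 - δ := by linarith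
    simpa using ((hexp (δ ^ 2 * (1 - δ) / (2 * (σ : ℝ) ^ 2)) (by positivity)).add
      (((tendsto_mul_exp_neg_mul_sqrt_sqrt (c := p / (8 * (σ : ℝ) ^ 2)) (by positivity)).comp
        hN).const_mul 2)).add (hexp (ε / 2 / (2 * (σ : ℝ) ^ 2)) (by positivity))
  refine squeeze_zero' (Eventually.of_forall fun A => ?_) ?_ hlim
  · exact div_nonneg (Finset.sum_nonneg fun _ _ => measureReal_nonneg) (Nat.cast_nonneg _)
  filter_upwards [hA, hPp, eventually_ge_atTop 1, hMtop.eventually_ge_atTop 2,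
    (tendsto_natCast_atTop_atTop (R := ℝ).comp hMtop).eventually_ge_atTop (2 / δ),
    hEtop.eventually_ge_atTop 0] with A hAlt hpA hA1 hM2 hMδ hE0
  simp only [Function.comp] at hMδ
  have hP0 : 0 ≤ P A := hp.le.trans hpA
  have hM4 : M A ^ 4 ≤ N A := sqrt_sqrt_pow_le _
  have hMN : M A * M A < N A := by nlinarith [Nat.mul_le_mul hM2 hM2]
  -- Since `M A ≥ 2 / δ`, `m (m + 1) ≤ 2 m² ≤ δ m³ ≤ δ N`.
  have hweight : (M A : ℝ) * (M A + 1) ≤ δ * N A := by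
    have h2 : (2 : ℝ) ≤ M A := by exact_mod_cast hM2
    have h4 : (M A : ℝ) ^ 4 ≤ N A := by exact_mod_cast hM4
    rw [div_le_iff₀ hδ] at hMδ
    have h5 : (M A : ℝ) * (M A + 1) ≤ 2 * (M A : ℝ) ^ 2 := by nlinarith
    have h6 : 2 * (M A : ℝ) ^ 2 ≤ (M A * δ) * (M A : ℝ) ^ 2 :=
      mul_le_mul_of_nonneg_right hMδ (sq_nonneg _)
    have h7 : (M A : ℝ) ^ 3 ≤ (M A : ℝ) ^ 4 := pow_le_pow_right₀ (by linarith) (by norm_num)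
    have h8 : δ * (M A : ℝ) ^ 3 ≤ δ * N A := mul_le_mul_of_nonneg_left (h7.trans h4) hδ.le
    nlinarith
  have hw : ∀ t, (1 - δ) * E A ≤ ∑ n ∈ Finset.Ico t (t + N A),
      channelInput (blockWord (N A) (M A) (P A)) t n ^ 2 := fun t => by
    refine le_trans ?_ (le_energy_blockWord (N := N A) (m := M A) hP0 t)
    simp only [hE, syncEnergy]
    nlinarith [mul_le_mul_of_nonneg_right hweight hP0]
  refine (frameErrorProb_syncDecoder_le σ _ hδ.le hδ1.le hw
    (le_dist_shift_blockWord hP0 hMN) hA1).trans (add_le_add (add_le_add ?_ ?_) ?_)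
  · refine Real.exp_le_exp.2 (le_of_eq ?_)
    ring
  · refine mul_le_mul_of_nonneg_left (mul_le_mul_of_nonneg_left (Real.exp_le_exp.2 ?_)
      (Nat.cast_nonneg _)) (by norm_num)
    rw [neg_mul, neg_div, neg_le_neg_iff, div_mul_eq_mul_div, mul_comm p]
    gcongr
  · refine (mul_le_mul_of_nonneg_right hAlt.le (Real.exp_pos _).le).trans ?_
    rw [← Real.exp_add]
    refine Real.exp_le_exp.2 ?_
    have h1 : 1 - ε / 2 ≤ (1 - δ) ^ 3 := by nlinarith [sq_nonneg δ, mul_pos hδ hδ]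
    have h2 : (1 - ε) * E A + ε / 2 * E A ≤ (1 - δ) ^ 3 * E A := by nlinarith
    have h3 : (1 - ε) * (E A / (2 * (σ : ℝ) ^ 2)) +
        -((1 - δ) ^ 2 * ((1 - δ) * E A)) / (2 * (σ : ℝ) ^ 2) =
        ((1 - ε) * E A - (1 - δ) ^ 3 * E A) / (2 * (σ : ℝ) ^ 2) := by ring
    have h4 : -(ε / 2 / (2 * (σ : ℝ) ^ 2) * E A) = (-(ε / 2 * E A)) / (2 * (σ : ℝ) ^ 2) := by ring
    rw [h4]
    refine (h3.trans_le ?_)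
    gcongr
    linarith
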